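/- Let $(\Omega,\mathcal F,\mathbb P)$ be a probability space with a measurable measure-preserving flow $(\theta_t)_{t\in\mathbb R}$ (that is, $(t,\omega)\mapsto\theta_t\omega$ is measurable, $\theta_0=\mathrm{id}$, $\theta_{s+t}=\theta_s\circ\theta_t$, and each $\theta_t$ preserves $\mathbb P$). Let $(X,d)$ be a complete separable metric space, not necessarily compact, and let $\varphi$ be a random dynamical system on $X$ over $\theta$ with two-sided time: a measurable map $(t,\omega,x)\mapsto\varphi(t,\omega)x$ from $\mathbb R\times\Omega\times X$ to $X$ such that each $\varphi(t,\omega):X\to X$ is continuous, $\varphi(0,\omega)=\mathrm{id}$ and $\varphi(s+t,\omega)=\varphi(s,\theta_t\omega)\circ\varphi(t,\omega)$. A *random closed set* is a map $\omega\mapsto D(\omega)$ with closed values in $X$ such that $\omega\mapsto \mathrm{dist}(x,D(\omega))$ is measurable for every $x\in X$ (where $\mathrm{dist}(x,\emptyset)=+\infty$); a *random open set* is a map $\omega\mapsto U(\omega)$ with open values such that $\omega\mapsto X\setminus U(\omega)$ is a random closed set. For a family $D=(D(\omega))_{\omega\in\Omega}$ of subsets of $X$ and $T\in\mathbb R$ put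 $$D_T(\omega)=\overline{\bigcup_{t\ge T}\varphi(t,\theta_{-t}\omega)D(\theta_{-t}\omega)},\qquad \Omega_D(\omega)=\bigcap_{T\ge 0}D_T(\omega).$$ $D$ is *invariant* if $\varphi(t,\omega)D(\omega)=D(\theta_t\omega)$ for all $t\in\mathbb R$, $\omega\in\Omega$, and *forward invariant* if $\varphi(t,\omega)D(\omega)\subseteq D(\theta_t\omega)$ for all $t\ge 0$, $\omega\in\Omega$. A random open set $U$ is *absorbing* if there are random variables $\epsilon,T:\Omega\to(0,\infty)$ such that, for every $\omega$, $U(\omega)$ contains the open $\epsilon(\omega)$-neighborhood of $U_{T(\omega)}(\omega)$. An *absorbing neighborhood* of $A$ is an absorbing random open set $U$ with $A(\omega)\subseteq U(\omega)$ for every $\omega$. An invariant random closed set $A$ is an *attractor determined by* $U$ if $U$ is an absorbing neighborhood of $A$ and $\Omega_U(\omega)=A(\omega)$ for every $\omega$. **Statement.** Let $A$ be an attractor determined by an absorbing neighborhood $U$. Then there is a forward invariant absorbing neighborhood $\tilde U$ of $A$ such that $U(\omega)\subseteq\tilde U(\omega)$ and $\Omega_{\tilde U}(\omega)=A(\omega)$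 for every $\omega\in\Omega$. -/

import Mathlib

open MeasureTheory

namespace RandomDS

/-- A measurable measure-preserving flow `θ` (a metric dynamical system) with time `ℝ`
on the probability space `(Ω, P)`. -/
structure BaseFlow (Ω : Type*) [MeasurableSpace Ω] (P : Measure Ω) where
  toFun : ℝ → Ω → Ω
  measurable' : Measurable (fun p : ℝ × Ω => toFun p.1 p.2)
  map_zero' : ∀ ω, toFun 0 ω = ω
  map_add' : ∀ s t ω, toFun (s + t) ω = toFun s (toFun t ω)
  measurePreserving' : ∀ t, MeasurePreserving (toFun t) P P

instance {Ω : Type*} [MeasurableSpace Ω] (P : Measure Ω) :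
    CoeFun (BaseFlow Ω P) (fun _ => ℝ → Ω → Ω) := ⟨BaseFlow.toFun⟩

/-- A (continuous) random dynamical system with two-sided time `ℝ` and state space `X` over the
base flow `θ`: a jointly measurable cocycle of continuous maps `φ t ω : X → X`. -/
structure RDS {Ω : Type*} [MeasurableSpace Ω] {P : Measure Ω} (θ : BaseFlow Ω P)
    (X : Type*) [TopologicalSpace X] [MeasurableSpace X] where
  toFun : ℝ → Ω → X → X
  measurable' : Measurable (fun p : ℝ × Ω × X => toFun p.1 p.2.1 p.2.2)
  continuous' : ∀ t ω, Continuous (toFun t ω)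
  map_zero' : ∀ ω x, toFun 0 ω x = x
  cocycle' : ∀ s t ω x, toFun (s + t) ω x = toFun s (θ t ω) (toFun t ω x)

instance {Ω : Type*} [MeasurableSpace Ω] {P : Measure Ω} (θ : BaseFlow Ω P)
    (X : Type*) [TopologicalSpace X] [MeasurableSpace X] :
    CoeFun (RDS θ X) (fun _ => ℝ → Ω → X → X) := ⟨RDS.toFun⟩

/-- Random closed set: closed values, and `ω ↦ dist (x, D ω)` is measurable for every `x`
(with the convention `dist (x, ∅) = ∞`). -/
def IsRandomClosed {Ω X : Type*} [MeasurableSpace Ω] [MetricSpace X] (D : Ω → Set X) : Prop :=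
  (∀ ω, IsClosed (D ω)) ∧ ∀ x : X, Measurable (fun ω => Metric.infEDist x (D ω))

/-- Random open set: open values, and the complement is a random closed set. -/
def IsRandomOpen {Ω X : Type*} [MeasurableSpace Ω] [MetricSpace X] (U : Ω → Set X) : Prop :=
  (∀ ω, IsOpen (U ω)) ∧ IsRandomClosed (fun ω => (U ω)ᶜ)

section

variable {Ω : Type*} [MeasurableSpace Ω] {P : Measure Ω} {θ : BaseFlow Ω P}
  {X : Type*} [MetricSpace X] [MeasurableSpace X]

/-- `φ(t, ω) D(ω) = D(θ_t ω)` for all times. -/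
def IsInvariant (φ : RDS θ X) (D : Ω → Set X) : Prop :=
  ∀ (t : ℝ) (ω : Ω), φ t ω '' D ω = D (θ t ω)

/-- `φ(t, ω) D(ω) ⊆ D(θ_t ω)` for all nonnegative times. -/
def IsForwardInvariant (φ : RDS θ X) (D : Ω → Set X) : Prop :=
  ∀ (t : ℝ), 0 ≤ t → ∀ ω : Ω, φ t ω '' D ω ⊆ D (θ t ω)

/-- The closed pull-back tail `closure (⋃_{t ≥ T} φ(t, θ_{-t} ω) D(θ_{-t} ω))`. -/
def pullbackTail (φ : RDS θ X) (D : Ω → Set X) (T : ℝ) (ω : Ω) : Set X :=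
  closure (⋃ (t : ℝ) (_ : T ≤ t), φ t (θ (-t) ω) '' D (θ (-t) ω))

/-- The (pull-back) omega-limit set `Ω_D`. -/
def omegaLimitSet (φ : RDS θ X) (D : Ω → Set X) (ω : Ω) : Set X :=
  ⋂ (T : ℝ) (_ : 0 ≤ T), pullbackTail φ D T ω

/-- A random open set `U` is `ε`-absorbing if, for some random variable `T > 0`, it contains the
open `ε`-neighborhood of its pull-back tail from time `T` on. -/
def IsEpsAbsorbing (φ : RDS θ X) (ε : Ω → ℝ) (U : Ω → Set X) : Prop :=
  IsRandomOpen U ∧ ∃ T : Ω → ℝ, Measurable T ∧ (∀ ω, 0 < T ω) ∧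
    ∀ ω, Metric.thickening (ε ω) (pullbackTail φ U (T ω) ω) ⊆ U ω

/-- A random open set is absorbing if it is `ε`-absorbing for some random variable `ε > 0`. -/
def IsAbsorbing (φ : RDS θ X) (U : Ω → Set X) : Prop :=
  ∃ ε : Ω → ℝ, Measurable ε ∧ (∀ ω, 0 < ε ω) ∧ IsEpsAbsorbing φ ε U

/-- `U` is an absorbing neighborhood of `A`. -/
def IsAbsorbingNhd (φ : RDS θ X) (U A : Ω → Set X) : Prop :=
  IsAbsorbing φ U ∧ ∀ ω, A ω ⊆ U ω

/-- `A` is a (local) attractor determined by its absorbing neighborhood `U`: `A` is an invariant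
random closed set and `A = Ω_U`. -/
def IsAttractorDeterminedBy (φ : RDS θ X) (A U : Ω → Set X) : Prop :=
  IsRandomClosed A ∧ IsInvariant φ A ∧ IsAbsorbingNhd φ U A ∧ ∀ ω, omegaLimitSet φ U ω = A ω

end

end RandomDS

/-! Enlarge U(ω) to the set V(ω) of points with a neighborhood that the flow carries into U(θ_s ω)
for almost every s ≥ T(θ_s ω). Absorption gives U ⊆ V, and forward invariance holds because a time
shift preserves the bound on s. If x ∈ V(θ_{-t} ω) and t is large, the orbit of x lies in U(θ_{-r}
ω) for some r ≥ r₀. Thus late tails of V lie in the tail of U from r₀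
(`pullbackTail_lateInterior_subset`): r₀ = T(ω) gives absorption, arbitrary r₀ gives Ω_V = Ω_U.
Neglecting null sets of times lets Fubini, rather than a projection theorem, give measurability. -/

namespace RandomDS

open Topology

/-! ### Essential unions of families of sets -/

section EssentialUnion

variable {S X : Type*} [MeasurableSpace S] [TopologicalSpace X]

/-- The points all of whose neighborhoods meet `K s` for a non-null set of parameters `s`. -/
def essUnionClosure (μ : Measure S) (K : S → Set X) : Set X :=
  {x | ∀ G ∈ 𝓝 x, μ {s | (K s ∩ G).Nonempty} ≠ 0}

theorem isClosed_essUnionClosure (μ : Measure S) (K : S → Set X) :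
    IsClosed (essUnionClosure μ K) := by
  rw [← isOpen_compl_iff, isOpen_iff_mem_nhds]
  intro x hx
  simp only [essUnionClosure, Set.mem_compl_iff, Set.mem_ofPred_eq, not_forall, not_not] at hx
  obtain ⟨G, hG, h0⟩ := hx
  filter_upwards [eventually_mem_nhds_iff.2 hG] with y hy hy'
  exact hy' G hy h0

theorem essUnionClosure_subset (μ : Measure S) {K : S → Set X} {F : Set X} (hF : IsClosed F)
    (hK : ∀ s, K s ⊆ F) : essUnionClosure μ K ⊆ F := by
  intro x hx
  by_contra hxF
  refine hx Fᶜ (hF.isOpen_compl.mem_nhds hxF) ?_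
  convert measure_empty (μ := μ)
  refine Set.eq_empty_of_forall_notMem fun s hs => ?_
  obtain ⟨z, hz, hzF⟩ := hs
  exact hzF (hK s hz)

theorem measure_setOf_mem_eq_zero {μ : Measure S} {K : S → Set X} {x : X}
    (hx : x ∉ essUnionClosure μ K) : μ {s | x ∈ K s} = 0 := by
  simp only [essUnionClosure, Set.mem_ofPred_eq, not_forall, not_not] at hx
  obtain ⟨G, hG, h0⟩ := hx
  refine measure_mono_null ?_ h0
  exact fun s hs => ⟨x, hs, mem_of_mem_nhds hG⟩

/-- If the essential union misses `G`, countably many basic open sets, each met only for null many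
parameters, cover `G`. -/
theorem essUnionClosure_inter_nonempty_iff [SecondCountableTopology X] (μ : Measure S)
    (K : S → Set X) {G : Set X} (hG : IsOpen G) :
    (essUnionClosure μ K ∩ G).Nonempty ↔ μ {s | (K s ∩ G).Nonempty} ≠ 0 := by
  constructor
  · rintro ⟨x, hx, hxG⟩
    exact hx G (hG.mem_nhds hxG)
  · intro h
    by_contra hne
    apply h
    let B := TopologicalSpace.countableBasis X
    let N : Set (Set X) := {b ∈ B | μ {s | (K s ∩ b).Nonempty} = 0}
    have hN : N.Countable := (TopologicalSpace.countable_countableBasis X).mono fun b hb => hb.1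
    refine measure_mono_null ?_ ((measure_biUnion_null_iff hN).2 fun b hb => hb.2)
    rintro s ⟨z, hzK, hzG⟩
    have hz : z ∉ essUnionClosure μ K := fun hz => hne ⟨z, hz, hzG⟩
    simp only [essUnionClosure, Set.mem_ofPred_eq, not_forall, not_not] at hz
    obtain ⟨G', hG', h0⟩ := hz
    obtain ⟨b, hb, hzb, hbG⟩ :=
      (TopologicalSpace.isBasis_countableBasis X).mem_nhds_iff.1 hG'
    refine Set.mem_biUnion (x := b) ⟨hb, measure_mono_null ?_ h0⟩ ⟨z, hzK, hzb⟩
    exact fun s' hs' => hs'.mono (Set.inter_subset_inter_right _ hbG)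

end EssentialUnion

/-- Hitting sets of images of a random closed set under a Carathéodory map are measurable. -/
theorem measurableSet_exists_image_edist_lt {Y Ω X : Type*} [MeasurableSpace Y]
    [MeasurableSpace Ω] [MetricSpace X] [TopologicalSpace.SeparableSpace X] [MeasurableSpace X]
    [BorelSpace X] {C : Ω → Set X} (hC : ∀ x, Measurable fun ω => Metric.infEDist x (C ω))
    {p : Y → Ω} (hp : Measurable p) {f : Y → X → X} (hf : ∀ x, Measurable fun y => f y x)
    (hfc : ∀ y, Continuous (f y)) (x : X) (r : ENNReal) :
    MeasurableSet {y | ∃ z ∈ C (p y), edist x (f y z) < r} := by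
  obtain ⟨D, hDc, hD⟩ := TopologicalSpace.exists_countable_dense X
  let I : Set (NNReal × X × ℚ) :=
    {i | (∃ q : ℚ, i.1 = Real.toNNReal q) ∧ (i.1 : ENNReal) < r ∧ i.2.1 ∈ D}
  have hI : I.Countable := by
    refine (((Set.countable_range fun q : ℚ => Real.toNNReal q).prod
      (hDc.prod (Set.to_countable (Set.univ : Set ℚ))))).mono ?_
    rintro ⟨a, b, c⟩ ⟨⟨q, hq⟩, -, hb⟩
    exact ⟨⟨q, hq.symm⟩, hb, trivial⟩
  -- By continuity, a rational ball around a point of the dense set `D` contains `z` and is mapped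
  -- within `q < r` of `x`. The bound `≤ q` is closed, so checking it on `D` suffices.
  have key : {y | ∃ z ∈ C (p y), edist x (f y z) < r} = ⋃ i ∈ I,
      ({y | Metric.infEDist i.2.1 (C (p y)) < ENNReal.ofReal i.2.2} ∩
        ⋂ d ∈ {d ∈ D | edist i.2.1 d < ENNReal.ofReal i.2.2},
          {y | edist x (f y d) ≤ (i.1 : ENNReal)}) := by
    ext y
    simp only [Set.mem_ofPred_eq, Set.mem_iUnion, Set.mem_inter_iff, Set.mem_iInter]
    constructor
    · rintro ⟨z, hz, hzr⟩
      obtain ⟨q, -, hzq, hqr⟩ := ENNReal.lt_iff_exists_rat_btwn.1 hzr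
      have hopen : IsOpen {w | edist x (f y w) < (Real.toNNReal q : ENNReal)} :=
        isOpen_lt (continuous_const.edist (hfc y)) continuous_const
      obtain ⟨e, he, hball⟩ := Metric.isOpen_iff.1 hopen z hzq
      obtain ⟨c, hc0, hce⟩ := exists_rat_btwn (half_pos he)
      have hc0' : (0 : ℝ) < c := hc0
      obtain ⟨d, hdD, hd⟩ := hD.exists_dist_lt z hc0'
      refine ⟨(Real.toNNReal q, d, c), ⟨⟨q, rfl⟩, hqr, hdD⟩, ?_, ?_⟩
      · refine Metric.infEDist_lt_iff.2 ⟨z, hz, ?_⟩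
        rw [edist_dist, ENNReal.ofReal_lt_ofReal_iff hc0', dist_comm]
        exact hd
      · rintro w ⟨-, hw⟩
        rw [edist_dist, ENNReal.ofReal_lt_ofReal_iff hc0'] at hw
        refine (hball (Metric.mem_ball.2 ?_) : edist x (f y w) < _).le
        have := dist_triangle w d z
        rw [dist_comm w d, dist_comm d z] at this
        linarith
    · rintro ⟨⟨q, d, c⟩, ⟨-, hqr, -⟩, hd, hw⟩
      obtain ⟨z, hz, hdz⟩ := Metric.infEDist_lt_iff.1 hd
      refine ⟨z, hz, lt_of_le_of_lt ?_ hqr⟩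
      have hO : IsOpen {w | edist d w < ENNReal.ofReal c} :=
        isOpen_lt (continuous_const.edist continuous_id) continuous_const
      have hF : IsClosed {w | edist x (f y w) ≤ (q : ENNReal)} :=
        isClosed_le (continuous_const.edist (hfc y)) continuous_const
      refine closure_minimal ?_ hF (hD.open_subset_closure_inter hO hdz)
      rintro w ⟨hw1, hwD⟩
      exact hw w ⟨hwD, hw1⟩
  rw [key]
  refine MeasurableSet.biUnion hI fun i _ => MeasurableSet.inter ?_ ?_
  · exact measurableSet_lt ((hC _).comp hp) measurable_const
  · refine MeasurableSet.biInter (hDc.mono fun d hd => hd.1) fun d _ => ?_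
    exact measurableSet_le (measurable_const.edist (hf d)) measurable_const

/-! ### The enlarged neighborhood and its pull-back tails -/

section

variable {Ω : Type*} [MeasurableSpace Ω] {P : Measure Ω} {θ : BaseFlow Ω P}

theorem BaseFlow.neg_apply_apply (θ : BaseFlow Ω P) (t : ℝ) (ω : Ω) : θ (-t) (θ t ω) = ω := by
  rw [← θ.map_add', neg_add_cancel, θ.map_zero']

variable {X : Type*} [MetricSpace X] [MeasurableSpace X]

theorem RDS.neg_apply_apply (φ : RDS θ X) (t : ℝ) (ω : Ω) (x : X) :
    φ (-t) (θ t ω) (φ t ω x) = x := by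
  rw [← φ.cocycle', neg_add_cancel, φ.map_zero']

theorem RDS.apply_neg_apply (φ : RDS θ X) (t : ℝ) (ω : Ω) (x : X) :
    φ t ω (φ (-t) (θ t ω) x) = x := by
  have h := φ.neg_apply_apply (-t) (θ t ω) x
  rwa [neg_neg, θ.neg_apply_apply] at h

theorem pullbackTail_mono (φ : RDS θ X) {D E : Ω → Set X} (h : ∀ ω, D ω ⊆ E ω) (T : ℝ) (ω : Ω) :
    pullbackTail φ D T ω ⊆ pullbackTail φ E T ω :=
  closure_mono (Set.iUnion₂_mono fun _ _ => Set.image_mono (h _))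

theorem image_subset_pullbackTail (φ : RDS θ X) (D : Ω → Set X) {T t : ℝ} (h : T ≤ t) (ω : Ω) :
    φ t (θ (-t) ω) '' D (θ (-t) ω) ⊆ pullbackTail φ D T ω :=
  (Set.subset_iUnion₂ (s := fun t (_ : T ≤ t) => φ t (θ (-t) ω) '' D (θ (-t) ω)) t h).trans
    subset_closure

/-- The states that lie outside `U` at time `s`, provided that the absorption time of `U` at the
position reached by the base flow is at most `s`. -/
def lateExterior (φ : RDS θ X) (U : Ω → Set X) (T : Ω → ℝ) (ω : Ω) (s : ℝ) : Set X :=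
  {z | T (θ s ω) ≤ s ∧ φ s ω z ∉ U (θ s ω)}

/-- The states that, uniformly in a neighborhood, lie in `U` at almost every time exceeding the
absorption time. -/
def lateInterior (φ : RDS θ X) (U : Ω → Set X) (T : Ω → ℝ) (ω : Ω) : Set X :=
  (essUnionClosure volume (lateExterior φ U T ω))ᶜ

/-- For `t ≥ 0`, an exceptional time `s` seen from `θ t ω` becomes `s + t` seen from `ω`, and
Lebesgue measure is translation invariant. -/
theorem isForwardInvariant_lateInterior (φ : RDS θ X) (U : Ω → Set X) (T : Ω → ℝ) :
    IsForwardInvariant φ (lateInterior φ U T) := by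
  rintro t ht ω _ ⟨x, hx, rfl⟩ hQ
  refine hx fun G hG h0 => ?_
  have hG' : φ (-t) (θ t ω) ⁻¹' G ∈ 𝓝 (φ t ω x) := by
    refine (φ.continuous' (-t) (θ t ω)).continuousAt ?_
    rwa [φ.neg_apply_apply]
  refine hQ _ hG' (measure_mono_null ?_ ((measure_preimage_add_right volume t _).trans h0))
  rintro s ⟨z, ⟨hT, hz⟩, hzG⟩
  refine ⟨φ (-t) (θ t ω) z, ⟨?_, ?_⟩, hzG⟩
  · rw [θ.map_add']
    linarith
  · rwa [φ.cocycle', φ.apply_neg_apply, θ.map_add']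

theorem subset_lateInterior (φ : RDS θ X) {U : Ω → Set X} {T : Ω → ℝ} (hU : ∀ ω, IsOpen (U ω))
    (hT : ∀ ω, pullbackTail φ U (T ω) ω ⊆ U ω) (ω : Ω) : U ω ⊆ lateInterior φ U T ω := by
  rw [lateInterior, Set.subset_compl_comm]
  refine essUnionClosure_subset _ (hU ω).isClosed_compl ?_
  rintro s z ⟨hs, hz⟩ hzU
  refine hz (hT _ (image_subset_pullbackTail φ U hs _ ?_))
  rw [θ.neg_apply_apply]
  exact ⟨z, hzU, rfl⟩

theorem isRandomOpen_lateInterior [TopologicalSpace.SeparableSpace X] [BorelSpace X]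
    (φ : RDS θ X) {U : Ω → Set X} {T : Ω → ℝ} (hU : IsRandomOpen U) (hT : Measurable T) :
    IsRandomOpen (lateInterior φ U T) := by
  have := UniformSpace.secondCountable_of_separable X
  refine ⟨fun ω => (isClosed_essUnionClosure _ _).isOpen_compl,
    fun ω => (isClosed_essUnionClosure _ _).isOpen_compl.isClosed_compl, fun x => ?_⟩
  refine measurable_of_Iio fun r => ?_
  let E : Set (ℝ × Ω) := {y | T (θ y.1 y.2) ≤ y.1} ∩
    {y | ∃ z ∈ (U (θ y.1 y.2))ᶜ, edist x (φ (-y.1) (θ y.1 y.2) z) < r}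
  have hθ : Measurable fun y : ℝ × Ω => θ y.1 y.2 := θ.measurable'
  have hE : MeasurableSet E := by
    refine (measurableSet_le (hT.comp hθ) measurable_fst).inter ?_
    refine measurableSet_exists_image_edist_lt hU.2.2 hθ (fun z => ?_)
      (fun y => φ.continuous' _ _) x r
    exact φ.measurable'.comp (measurable_fst.neg.prodMk (hθ.prodMk measurable_const))
  have key : (fun ω => Metric.infEDist x (lateInterior φ U T ω)ᶜ) ⁻¹' Set.Iio r =
      {ω | volume ((fun s : ℝ => (s, ω)) ⁻¹' E) ≠ 0} := by
    ext ω
    have hO : IsOpen {w | edist x w < r} :=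
      isOpen_lt (continuous_const.edist continuous_id) continuous_const
    have hset : {s | (lateExterior φ U T ω s ∩ {w | edist x w < r}).Nonempty} =
        (fun s : ℝ => (s, ω)) ⁻¹' E := by
      ext s
      constructor
      · rintro ⟨z, ⟨hs, hz⟩, hzr⟩
        refine ⟨hs, φ s ω z, hz, ?_⟩
        rw [φ.neg_apply_apply]
        exact hzr
      · rintro ⟨hs, z, hz, hzr⟩
        refine ⟨φ (-s) (θ s ω) z, ⟨hs, ?_⟩, hzr⟩
        rwa [φ.apply_neg_apply]
    rw [Set.mem_ofPred_eq, ← hset, ← essUnionClosure_inter_nonempty_iff volume _ hO,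
      Set.mem_preimage, Set.mem_Iio, Metric.infEDist_lt_iff, lateInterior, compl_compl]
    rfl
  rw [key]
  exact (measurable_measure_prodMk_right hE) (measurableSet_singleton 0).compl

/-- The times `r ≥ r₀` at which a state absorbed from `θ (-r) ω` on has been absorbed by time
`n` before reaching `ω`. -/
def absorbedTimes (θ : BaseFlow Ω P) (T : Ω → ℝ) (ω : Ω) (r₀ : ℝ) (n : ℕ) : Set ℝ :=
  {r | r₀ ≤ r ∧ r + T (θ (-r) ω) ≤ n}

/-- As `n` grows these sets exhaust a half-line, so they cannot all be null. -/
theorem exists_measure_absorbedTimes_ne_zero (θ : BaseFlow Ω P) (T : Ω → ℝ) (ω : Ω) (r₀ : ℝ) :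
    ∃ n, volume (absorbedTimes θ T ω r₀ n) ≠ 0 := by
  by_contra! h
  have hsub : Set.Ici r₀ ⊆ ⋃ n, absorbedTimes θ T ω r₀ n := fun r hr => by
    obtain ⟨n, hn⟩ := exists_nat_ge (r + T (θ (-r) ω))
    exact Set.mem_iUnion.2 ⟨n, hr, hn⟩
  have h0 := measure_mono_null hsub (measure_iUnion_null h)
  simp at h0

/-- The exceptional times of a single orbit are null, so a non-null set of candidates `r` contains
one at which the orbit is in `U`. -/
theorem pullbackTail_lateInterior_subset (φ : RDS θ X) (U : Ω → Set X) (T : Ω → ℝ) (ω : Ω)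
    {r₀ : ℝ} {n : ℕ} (hn : volume (absorbedTimes θ T ω r₀ n) ≠ 0) {T' : ℝ} (hT' : n ≤ T') :
    pullbackTail φ (lateInterior φ U T) T' ω ⊆ pullbackTail φ U r₀ ω := by
  refine closure_minimal (Set.iUnion₂_subset fun t ht => ?_) isClosed_closure
  rintro _ ⟨x, hx, rfl⟩
  have h0 : volume ((fun r => t - r) ⁻¹' {s | x ∈ lateExterior φ U T (θ (-t) ω) s}) = 0 :=
    (Measure.measurePreserving_sub_left volume t).quasiMeasurePreserving.preimage_null
      (measure_setOf_mem_eq_zero hx)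
  obtain ⟨r, ⟨hr0, hrn⟩, hr⟩ : ∃ r ∈ absorbedTimes θ T ω r₀ n,
      x ∉ lateExterior φ U T (θ (-t) ω) (t - r) := by
    by_contra! h
    exact hn (measure_mono_null h h0)
  have hθ : θ (t - r) (θ (-t) ω) = θ (-r) ω := by
    rw [← θ.map_add']
    congr 1
    ring
  have hxU : φ (t - r) (θ (-t) ω) x ∈ U (θ (-r) ω) := by
    by_contra hxU
    refine hr ⟨?_, ?_⟩ <;> rw [hθ]
    · linarith
    · exact hxU
  refine image_subset_pullbackTail φ U hr0 ω ⟨_, hxU, ?_⟩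
  rw [← hθ, ← φ.cocycle', add_sub_cancel]

theorem exists_measurable_absorbedTimes (θ : BaseFlow Ω P) {T : Ω → ℝ} (hT : Measurable T) :
    ∃ N : Ω → ℕ, Measurable N ∧ ∀ ω, volume (absorbedTimes θ T ω (T ω) (N ω)) ≠ 0 := by
  classical
  have hex := fun ω => exists_measure_absorbedTimes_ne_zero θ T ω (T ω)
  refine ⟨fun ω => Nat.find (hex ω), measurable_find hex fun n => ?_,
    fun ω => Nat.find_spec (hex ω)⟩
  have hE : MeasurableSet {y : ℝ × Ω | T y.2 ≤ y.1 ∧ y.1 + T (θ (-y.1) y.2) ≤ n} := by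
    have hθ : Measurable fun y : ℝ × Ω => θ (-y.1) y.2 :=
      θ.measurable'.comp (measurable_fst.neg.prodMk measurable_snd)
    exact (measurableSet_le (hT.comp measurable_snd) measurable_fst).inter
      (measurableSet_le (measurable_fst.add (hT.comp hθ)) measurable_const)
  exact (measurable_measure_prodMk_right hE) (measurableSet_singleton 0).compl

end

end RandomDS

theorem mainTheorem12 {Ω : Type*} [MeasurableSpace Ω] {P : MeasureTheory.Measure Ω}
    [MeasureTheory.IsProbabilityMeasure P] (θ : RandomDS.BaseFlow Ω P)
    {X : Type*} [MetricSpace X] [CompleteSpace X] [TopologicalSpace.SeparableSpace X]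
    [MeasurableSpace X] [BorelSpace X] (φ : RandomDS.RDS θ X)
    (A U : Ω → Set X) (hA : RandomDS.IsAttractorDeterminedBy φ A U) :
    ∃ V : Ω → Set X,
      RandomDS.IsForwardInvariant φ V ∧
      RandomDS.IsAbsorbingNhd φ V A ∧
      (∀ ω, U ω ⊆ V ω) ∧
      ∀ ω, RandomDS.omegaLimitSet φ V ω = A ω := by
  obtain ⟨-, -, ⟨⟨ε, hε, hε0, hU, T, hT, -, hTU⟩, hAU⟩, hlim⟩ := hA
  have hUV := RandomDS.subset_lateInterior φ hU.1
    fun ω => (Metric.self_subset_thickening (hε0 ω) _).trans (hTU ω)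
  obtain ⟨N, hN, hNT⟩ := RandomDS.exists_measurable_absorbedTimes θ hT
  -- The same `ε` serves, since the new tail lies in the old one; the `+ 1` makes the absorption
  -- time positive.
  refine ⟨RandomDS.lateInterior φ U T, RandomDS.isForwardInvariant_lateInterior φ U T,
    ⟨⟨ε, hε, hε0, RandomDS.isRandomOpen_lateInterior φ hU hT, fun ω => N ω + 1,
      (measurable_from_nat.comp hN).add_const 1, fun ω => by positivity, fun ω => ?_⟩,
      fun ω => (hAU ω).trans (hUV ω)⟩, hUV, fun ω => ?_⟩
  · refine (Metric.thickening_subset_of_subset _ ?_).trans ((hTU ω).trans (hUV ω))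
    exact RandomDS.pullbackTail_lateInterior_subset φ U T ω (hNT ω) (by simp)
  · rw [← hlim ω]
    refine Set.Subset.antisymm (Set.subset_iInter₂ fun r₀ _ => ?_)
      (Set.iInter₂_mono fun r _ => RandomDS.pullbackTail_mono φ hUV r ω)
    obtain ⟨n, hn⟩ := RandomDS.exists_measure_absorbedTimes_ne_zero θ T ω r₀
    exact (Set.iInter₂_subset (n : ℝ) n.cast_nonneg).trans
      (RandomDS.pullbackTail_lateInterior_subset φ U T ω hn le_rfl)
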